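/- All spaces are over $\mathbb{R}$. For Banach spaces $X,Y$ and a bounded linear operator $T:X\to Y$, write $S_X=\{x\in X:\|x\|=1\}$ and let $M_T=\{x\in S_X:\|Tx\|=\|T\|\}$ be the norm attainment set of $T$. For $\epsilon>0$ and operators $T,A:X\to Y$ with $\|T\|=\|A\|=1$, we say that $A$ is a uniform $\epsilon$-BPB approximation of $T$ if there exists $\delta>0$ such that for each $x_0\in S_X$ with $\|Tx_0\|>1-\delta$ there exists $u_0\in M_A$ with $\|u_0-x_0\|<\epsilon$ and $\|T-A\|<\epsilon$; it is called non-trivial if moreover $A\neq T$. The pair $(X,Y)$ has the non-trivial norm preserving uniform BPB approximation property if for every bounded linear operator $T:X\to Y$ with $\|T\|=1$ that is not an isometry and every $\epsilon>0$, there is a non-trivial uniform $\epsilon$-BPB approximation $A_\epsilon$ of $T$ with $M_T=M_{A_\epsilon}$. Let $n\in\mathbb{N}$ and let $\ell_\infty^n$ be $\mathbb{R}^n$ with the maximum norm. Let $T:\ell_\infty^n\to\ell_\infty^n$ be a linear operator with $\|T\|=1$. Then $T$ is an isometry if and only if there exists $\epsilon_0>0$ such that for each $0<\epsilon<\epsilon_0$,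 $T$ is the only uniform $\epsilon$-BPB approximation of $T$. Moreover, the pair $(\ell_\infty^n,\ell_\infty^n)$ has the non-trivial norm preserving uniform BPB approximation property. -/

import Mathlib

namespace BPB

/-- The real space `ℓ_∞^n`: in Mathlib the function space `Fin n → ℝ` carries the sup norm. -/
abbrev EllInfty (n : ℕ) : Type := Fin n → ℝ

section

variable {X Y : Type*} [NormedAddCommGroup X] [NormedSpace ℝ X]
  [NormedAddCommGroup Y] [NormedSpace ℝ Y]

/-- The norm attainment set `M_T` of a bounded linear operator `T`. -/
def normAttainmentSet (T : X →L[ℝ] Y) : Set X :=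
  {x | ‖x‖ = 1 ∧ ‖T x‖ = ‖T‖}

/-- `A` is a uniform `ε`-BPB approximation of `T`; both operators have norm one. -/
def IsUniformBPBApprox (ε : ℝ) (T A : X →L[ℝ] Y) : Prop :=
  ‖T‖ = 1 ∧ ‖A‖ = 1 ∧
    ∃ δ : ℝ, 0 < δ ∧ ∀ x₀ : X, ‖x₀‖ = 1 → 1 - δ < ‖T x₀‖ →
      ∃ u₀ ∈ normAttainmentSet A, ‖u₀ - x₀‖ < ε ∧ ‖T - A‖ < ε

/-- A uniform `ε`-BPB approximation of `T` that differs from `T`. -/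
def IsNontrivialUniformBPBApprox (ε : ℝ) (T A : X →L[ℝ] Y) : Prop :=
  IsUniformBPBApprox ε T A ∧ A ≠ T

end

/-- The pair `(X, Y)` has the non-trivial norm preserving uniform BPB approximation property. -/
def HasNontrivialNormPreservingUniformBPB (X Y : Type*) [NormedAddCommGroup X] [NormedSpace ℝ X]
    [NormedAddCommGroup Y] [NormedSpace ℝ Y] : Prop :=
  ∀ T : X →L[ℝ] Y, ‖T‖ = 1 → ¬ Isometry T → ∀ ε : ℝ, 0 < ε →
    ∃ A : X →L[ℝ] Y, IsNontrivialUniformBPBApprox ε T A ∧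
      normAttainmentSet T = normAttainmentSet A

end BPB

/-!
An operator `T` of norm one that is not an extreme point of the unit ball is a convex combination
`a • P + b • Q` with `P ≠ T`. At a norm-attaining vector of `T` both `P` and `Q` attain the value
one, so moving `T` slightly towards `P` keeps the norm attainment set; by compactness of the sphere
this gives non-trivial approximations of `T` at every scale.

If `T` maps `ℝ^ι` to `ℝ^κ`, both with the maximum norm, and is extreme, then every row of `T` is
extreme in the dual ball of `ℝ^ι`, which is an `ℓ¹` ball: each row is a signed coordinate
functional. When two rows involve the same coordinate, shrinking one of them changes no norm
`‖T x‖` at all, so there are non-trivial approximations again.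

The remaining operators select distinct coordinates up to sign, and they are rigid: if `A` is a
uniform approximation of `T` and `T` reads the coordinate `j` in its row `i`, then `A` attains its
norm near the unit vector `e_j`, and only in the row `i`, which forces this row of `A` to be `± x_j`
with the same sign as for `T`. In the square case these operators are the isometries.
-/

namespace BPB

section OpenSegment

theorem norm_eq_of_mem_openSegment {V : Type*} [SeminormedAddCommGroup V] [NormedSpace ℝ V]
    {x y z : V} {r : ℝ} (hy : ‖y‖ ≤ r) (hz : ‖z‖ ≤ r) (hx : x ∈ openSegment ℝ y z)
    (h : ‖x‖ = r) : ‖y‖ = r :=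
  hy.antisymm <| h ▸ convexOn_univ_norm.le_left_of_right_le (Set.mem_univ y) (Set.mem_univ z) hx
    (hz.trans_eq h.symm)

theorem mem_openSegment_add_smul_sub {V : Type*} [AddCommGroup V] [Module ℝ V] {x y z : V} {c : ℝ}
    (hc : 0 < c) (h : x ∈ openSegment ℝ y z) : x ∈ openSegment ℝ (x + c • (y - x)) z := by
  obtain ⟨a, b, ha, hb, hab, hx⟩ := h
  have hbc : 0 < b * c := mul_pos hb hc
  have hpos : 0 < a + b * c := add_pos ha hbc
  refine ⟨a / (a + b * c), b * c / (a + b * c), div_pos ha hpos, div_pos hbc hpos,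
    by field_simp, ?_⟩
  rw [div_eq_inv_mul, div_eq_inv_mul, mul_smul, mul_smul, ← smul_add, inv_smul_eq_iff₀ hpos.ne']
  calc a • (x + c • (y - x)) + (b * c) • z
      = (a - a * c) • x + c • (a • y + b • z) := by module
    _ = (a - a * c + (a + b) * c) • x := by rw [hx, hab]; module
    _ = (a + b * c) • x := by congr 1; ring

end OpenSegment

section NormAttainment

variable {X Y : Type*} [NormedAddCommGroup X] [NormedSpace ℝ X]
  [NormedAddCommGroup Y] [NormedSpace ℝ Y] {T A B : X →L[ℝ] Y} {ε : ℝ}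

/-- The conclusion of the norm preserving uniform BPB property for a single operator `T`: at every
scale `ε` there is a non-trivial uniform approximation with the norm attainment set of `T`. -/
def HasNontrivialNormPreservingApprox (T : X →L[ℝ] Y) : Prop :=
  ∀ ε : ℝ, 0 < ε → ∃ A : X →L[ℝ] Y,
    IsNontrivialUniformBPBApprox ε T A ∧ normAttainmentSet T = normAttainmentSet A

theorem exists_mem_normAttainmentSet_norm_sub_lt [ProperSpace X] (T : X →L[ℝ] Y) (hε : 0 < ε) :
    ∃ δ : ℝ, 0 < δ ∧ ∀ x : X, ‖x‖ = 1 → ‖T‖ - δ < ‖T x‖ →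
      ∃ u ∈ normAttainmentSet T, ‖u - x‖ < ε := by
  have hcompact : IsCompact (Metric.sphere 0 1 \ Metric.thickening ε (normAttainmentSet T)) :=
    (isCompact_sphere 0 1).diff Metric.isOpen_thickening
  have hgap : ∀ x ∈ Metric.sphere 0 1 \ Metric.thickening ε (normAttainmentSet T),
      0 < ‖T‖ - ‖T x‖ := by
    rintro x ⟨hx, hxT⟩
    rw [mem_sphere_zero_iff_norm] at hx
    refine sub_pos.2 ((T.unit_le_opNorm x hx.le).lt_of_ne fun h => hxT ?_)
    exact Metric.self_subset_thickening hε _ ⟨hx, h⟩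
  obtain ⟨δ, hδ, hle⟩ := hcompact.exists_forall_le' (by fun_prop) hgap
  refine ⟨δ, hδ, fun x hx hTx => ?_⟩
  have hxT : x ∈ Metric.thickening ε (normAttainmentSet T) := by
    by_contra hxT
    linarith [hle x ⟨mem_sphere_zero_iff_norm.2 hx, hxT⟩]
  simpa only [Metric.mem_thickening_iff, dist_eq_norm'] using hxT

theorem isUniformBPBApprox_of_normAttainmentSet_eq [ProperSpace X] (hT : ‖T‖ = 1) (hA : ‖A‖ = 1)
    (hTA : ‖T - A‖ < ε) (h : normAttainmentSet T = normAttainmentSet A) :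
    IsUniformBPBApprox ε T A := by
  obtain ⟨δ, hδ, hnear⟩ :=
    exists_mem_normAttainmentSet_norm_sub_lt T ((norm_nonneg _).trans_lt hTA)
  refine ⟨hT, hA, δ, hδ, fun x hx hTx => ?_⟩
  obtain ⟨u, hu, hux⟩ := hnear x hx (hT ▸ hTx)
  exact ⟨u, h ▸ hu, hux, hTA⟩

theorem hasNontrivialNormPreservingApprox_of_direction [ProperSpace X] (hT : ‖T‖ = 1)
    {R : X →L[ℝ] Y} (hR : R ≠ 0)
    (h : ∀ c ∈ Set.Ioo (0 : ℝ) 1,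
      ‖T + c • R‖ = 1 ∧ normAttainmentSet T = normAttainmentSet (T + c • R)) :
    HasNontrivialNormPreservingApprox T := by
  intro ε hε
  have hR_pos : 0 < ‖R‖ := norm_pos_iff.2 hR
  obtain ⟨c, hc0, hc⟩ : ∃ c : ℝ, 0 < c ∧ c < min 1 (ε / ‖R‖) :=
    exists_between (lt_min one_pos (div_pos hε hR_pos))
  obtain ⟨hc1, hcε⟩ := lt_min_iff.1 hc
  obtain ⟨hnorm, hset⟩ := h c ⟨hc0, hc1⟩
  refine ⟨T + c • R, ⟨isUniformBPBApprox_of_normAttainmentSet_eq hT hnorm ?_ hset, ?_⟩, hset⟩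
  · rw [sub_add_cancel_left, norm_neg, norm_smul, Real.norm_of_nonneg hc0.le]
    exact (lt_div_iff₀ hR_pos).1 hcε
  · rw [Ne, add_eq_left]
    exact smul_ne_zero hc0.ne' hR

theorem normAttainmentSet_subset_of_mem_openSegment (hA : ‖A‖ ≤ ‖T‖) (hB : ‖B‖ ≤ ‖T‖)
    (h : T ∈ openSegment ℝ A B) : normAttainmentSet T ⊆ normAttainmentSet A := by
  rintro x ⟨hx, hTx⟩
  have hxAB : T x ∈ openSegment ℝ (A x) (B x) := by
    obtain ⟨a, b, ha, hb, hab, rfl⟩ := h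
    exact ⟨a, b, ha, hb, hab, rfl⟩
  refine ⟨hx, (norm_eq_of_mem_openSegment hA hB h rfl).symm ▸ ?_⟩
  exact norm_eq_of_mem_openSegment ((A.unit_le_opNorm x hx.le).trans hA)
    ((B.unit_le_opNorm x hx.le).trans hB) hxAB hTx

theorem hasNontrivialNormPreservingApprox_of_notMem_extremePoints [ProperSpace X] (hT : ‖T‖ = 1)
    (h : T ∉ (Metric.closedBall (0 : X →L[ℝ] Y) 1).extremePoints ℝ) :
    HasNontrivialNormPreservingApprox T := by
  obtain ⟨P, hP, Q, hQ, hPQ, hPT⟩ : ∃ P, ‖P‖ ≤ 1 ∧ ∃ Q, ‖Q‖ ≤ 1 ∧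
      T ∈ openSegment ℝ P Q ∧ P ≠ T := by
    simpa [mem_extremePoints_iff_left, hT] using h
  refine hasNontrivialNormPreservingApprox_of_direction hT (sub_ne_zero.2 hPT) fun c hc => ?_
  set A := T + c • (P - T) with hA_def
  have hA_mem : A ∈ openSegment ℝ T P :=
    ⟨1 - c, c, sub_pos.2 hc.2, hc.1, sub_add_cancel _ _, by rw [hA_def]; module⟩
  have hT_mem : T ∈ openSegment ℝ A Q := mem_openSegment_add_smul_sub hc.1 hPQ
  have hA_le : ‖A‖ ≤ 1 := mem_closedBall_zero_iff.1 <|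
    (convex_closedBall 0 1).openSegment_subset (mem_closedBall_zero_iff.2 hT.le)
      (mem_closedBall_zero_iff.2 hP) hA_mem
  have hA : ‖A‖ = 1 := norm_eq_of_mem_openSegment hA_le hQ hT_mem hT
  refine ⟨hA, Set.Subset.antisymm ?_ ?_⟩
  · exact normAttainmentSet_subset_of_mem_openSegment (by rw [hA, hT]) (by rwa [hT]) hT_mem
  · exact normAttainmentSet_subset_of_mem_openSegment (by rw [hA, hT]) (by rwa [hA]) hA_mem

end NormAttainment

section Functional

variable {ι : Type*}

/-- The coordinate functional `x ↦ x j` on `ℝ^ι` with the maximum norm, introduced to fix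
the type of `ContinuousLinearMap.proj j`. -/
abbrev coord (j : ι) : (ι → ℝ) →L[ℝ] ℝ := ContinuousLinearMap.proj j

theorem exists_apply_single_ne_zero [Finite ι] [DecidableEq ι] {f : (ι → ℝ) →L[ℝ] ℝ}
    (hf : f ≠ 0) : ∃ j, f (Pi.single j 1) ≠ 0 := by
  contrapose! hf
  exact ContinuousLinearMap.coe_injective <|
    LinearMap.pi_ext' fun j => LinearMap.ext_ring (hf j)

variable [Fintype ι]

theorem norm_coord_le_one (j : ι) : ‖coord j‖ ≤ 1 :=
  ContinuousLinearMap.opNorm_le_bound _ zero_le_one fun x => by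
    rw [one_mul]
    exact norm_le_pi_norm x j

variable [DecidableEq ι] {f g : (ι → ℝ) →L[ℝ] ℝ} {j : ι}

theorem abs_apply_single_le_norm (f : (ι → ℝ) →L[ℝ] ℝ) (j : ι) : |f (Pi.single j 1)| ≤ ‖f‖ :=
  f.unit_le_opNorm _ (by rw [Pi.norm_single, norm_one])

theorem norm_sub_apply_single_smul_coord_le (f : (ι → ℝ) →L[ℝ] ℝ) (j : ι) :
    ‖f - f (Pi.single j 1) • coord j‖ ≤ ‖f‖ - |f (Pi.single j 1)| := by
  have habs_sign_le (r : ℝ) : |(SignType.sign r : ℝ)| ≤ 1 := by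
    rcases SignType.sign r with _ | _ | _ <;> simp
  set e : ι → ℝ := Pi.single j 1
  refine ContinuousLinearMap.opNorm_le_bound _ (sub_nonneg.2 (abs_apply_single_le_norm f j))
    fun x => ?_
  -- Choosing the signs of `y` and of the coordinate `j` of `w` independently adds up both parts.
  set y := x - x j • e with hy
  set w := (SignType.sign (f y) : ℝ) • y + (‖x‖ * SignType.sign (f e)) • e with hw
  have hfy : (f - f e • coord j) x = f y := by simp [hy, mul_comm]
  have hfw : f w = |f y| + |f e| * ‖x‖ := by
    rw [hw, map_add, map_smul, map_smul, smul_eq_mul, smul_eq_mul, sign_mul_self, mul_assoc,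
      sign_mul_self, mul_comm ‖x‖]
  have hwx : ‖w‖ ≤ ‖x‖ := by
    refine (pi_norm_le_iff_of_nonneg (norm_nonneg x)).2 fun k => ?_
    rcases eq_or_ne k j with rfl | hk
    · simpa [hw, hy, e] using mul_le_of_le_one_right (norm_nonneg x) (habs_sign_le (f e))
    · simpa [hw, hy, e, hk] using
        (mul_le_of_le_one_left (abs_nonneg (x k)) (habs_sign_le (f y))).trans (norm_le_pi_norm x k)
  rw [hfy, Real.norm_eq_abs]
  linarith [(le_abs_self _).trans (f.le_opNorm_of_le hwx)]

theorem eq_smul_coord_of_abs_apply_single_eq_one (hf : ‖f‖ ≤ 1)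
    (hj : |f (Pi.single j 1)| = 1) : f = f (Pi.single j 1) • coord j := by
  have h := norm_sub_apply_single_smul_coord_le f j
  exact sub_eq_zero.1 (norm_le_zero_iff.1 (h.trans (by linarith)))

theorem abs_apply_eq_abs_coord (hf : ‖f‖ ≤ 1) (hj : |f (Pi.single j 1)| = 1) (x : ι → ℝ) :
    |f x| = |x j| := by
  rw [eq_smul_coord_of_abs_apply_single_eq_one hf hj]
  simp [abs_mul, hj]

theorem abs_coord_eq_one_of_abs_apply_eq_one (hf : ‖f‖ ≤ 1) {u : ι → ℝ}
    (hu : ‖u‖ ≤ 1) (hfu : |f u| = 1) (hj : f (Pi.single j 1) ≠ 0) : |u j| = 1 := by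
  set t := f (Pi.single j 1)
  have hrest : |f u - t * u j| ≤ 1 - |t| := calc
    |f u - t * u j| = ‖(f - t • coord j) u‖ := rfl
    _ ≤ ‖f - t • coord j‖ := ContinuousLinearMap.unit_le_opNorm _ u hu
    _ ≤ ‖f‖ - |t| := norm_sub_apply_single_smul_coord_le f j
    _ ≤ 1 - |t| := sub_le_sub_right hf _
  have hmass : |t| ≤ |t| * |u j| := by
    have := abs_sub_abs_le_abs_sub (f u) (t * u j)
    rw [hfu, abs_mul] at this
    linarith
  exact ((norm_le_pi_norm u j).trans hu).antisymm
    ((le_mul_iff_one_le_right (abs_pos.2 hj)).1 hmass)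

theorem abs_apply_single_eq_one_of_norm_sub_lt_one (hf : ‖f‖ ≤ 1)
    {u : ι → ℝ} (hu : ‖u‖ ≤ 1) (hfu : |f u| = 1) (huj : ‖u - Pi.single j 1‖ < 1) :
    |f (Pi.single j 1)| = 1 := by
  have ht_le : |f (Pi.single j 1)| ≤ 1 := (abs_apply_single_le_norm f j).trans hf
  set e : ι → ℝ := Pi.single j 1 with he
  set t := f e with ht
  have hrest : |f u - t * u j| ≤ (1 - |t|) * ‖u - e‖ := calc
    |f u - t * u j| = ‖(f - t • coord j) (u - e)‖ := by
      simp [he, ht]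
      ring_nf
    _ ≤ ‖f - t • coord j‖ * ‖u - e‖ := ContinuousLinearMap.le_opNorm _ _
    _ ≤ (1 - |t|) * ‖u - e‖ := by
      gcongr
      exact (norm_sub_apply_single_smul_coord_le f j).trans (sub_le_sub_right hf _)
  have hcoord : |t * u j| ≤ |t| := by
    rw [abs_mul]
    exact mul_le_of_le_one_right (abs_nonneg t) ((norm_le_pi_norm u j).trans hu)
  have hgap : (1 - |t|) * (1 - ‖u - e‖) ≤ 0 := by
    have htri := abs_sub_abs_le_abs_sub (f u) (t * u j)
    rw [hfu] at htri
    linarith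
  exact ht_le.antisymm (sub_nonpos.1 (nonpos_of_mul_nonpos_left hgap (sub_pos.2 huj)))

theorem eq_of_norm_sub_lt_one (hf : ‖f‖ ≤ 1) (hg : ‖g‖ ≤ 1)
    (hfj : |f (Pi.single j 1)| = 1) (hgj : |g (Pi.single j 1)| = 1) (hfg : ‖f - g‖ < 1) :
    f = g := by
  have hlt : |f (Pi.single j 1) - g (Pi.single j 1)| < 1 :=
    (abs_apply_single_le_norm (f - g) j).trans_lt hfg
  rw [eq_smul_coord_of_abs_apply_single_eq_one hf hfj,
    eq_smul_coord_of_abs_apply_single_eq_one hg hgj]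
  congr 1
  rcases eq_or_eq_neg_of_abs_eq hfj with h | h <;> rcases eq_or_eq_neg_of_abs_eq hgj with h' | h'
  <;> rw [h, h'] at hlt ⊢ <;> norm_num at hlt

theorem exists_abs_apply_single_eq_one_of_mem_extremePoints [Nonempty ι]
    (hf : f ∈ (Metric.closedBall (0 : (ι → ℝ) →L[ℝ] ℝ) 1).extremePoints ℝ) :
    ∃ j, |f (Pi.single j 1)| = 1 := by
  have hf_norm : ‖f‖ = 1 :=
    mem_sphere_zero_iff_norm.1 (extremePoints_closedBall_subset_sphere hf)
  obtain ⟨j, hj⟩ := exists_apply_single_ne_zero (norm_ne_zero_iff.1 (hf_norm ▸ one_ne_zero))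
  refine ⟨j, ?_⟩
  by_contra hj1
  set t := f (Pi.single j 1)
  have ht0 : 0 < |t| := abs_pos.2 hj
  have ht1 : 0 < 1 - |t| := sub_pos.2 ((hf_norm ▸ abs_apply_single_le_norm f j).lt_of_ne hj1)
  -- `f` is a convex combination, with weights `|t|` and `1 - |t|`, of its normalised `j`-th part
  -- and the normalised rest.
  have hsign : ‖t / |t|‖ = 1 := by
    rw [norm_div, Real.norm_of_nonneg ht0.le]
    exact div_self ht0.ne'
  have hcoord : ‖(t / |t|) • coord j‖ ≤ 1 := by
    rw [norm_smul, hsign, one_mul]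
    exact norm_coord_le_one j
  have hrest : ‖(1 - |t|)⁻¹ • (f - t • coord j)‖ ≤ 1 := by
    rw [norm_smul, norm_inv, Real.norm_of_nonneg ht1.le, inv_mul_le_one₀ ht1]
    exact (norm_sub_apply_single_smul_coord_le f j).trans_eq (by rw [hf_norm])
  have heq : (t / |t|) • coord j = f := by
    refine (mem_extremePoints_iff_left.1 hf).2 _ (mem_closedBall_zero_iff.2 hcoord) _
      (mem_closedBall_zero_iff.2 hrest) ⟨|t|, 1 - |t|, ht0, ht1, add_sub_cancel _ _, ?_⟩
    rw [smul_smul, mul_div_cancel₀ _ ht0.ne', smul_inv_smul₀ ht1.ne', add_sub_cancel]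
  refine hj1 ?_
  calc |t| = ‖((t / |t|) • coord j) (Pi.single j 1)‖ := by rw [heq, Real.norm_eq_abs]
    _ = ‖t / |t|‖ := by simp
    _ = 1 := hsign

end Functional

section Row

variable {X κ : Type*}

/-- The functional `x ↦ T x i`, the `i`-th row of an operator `T` into `ℝ^κ`. -/
abbrev row [AddCommMonoid X] [Module ℝ X] [TopologicalSpace X] (T : X →L[ℝ] (κ → ℝ)) (i : κ) :
    X →L[ℝ] ℝ :=
  (coord i).comp T

variable [NormedAddCommGroup X] [NormedSpace ℝ X] [Fintype κ]

theorem norm_row_le (T : X →L[ℝ] (κ → ℝ)) (i : κ) : ‖row T i‖ ≤ ‖T‖ :=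
  ContinuousLinearMap.opNorm_le_bound _ (norm_nonneg T) fun x =>
    (norm_le_pi_norm (T x) i).trans (T.le_opNorm x)

theorem row_mem_extremePoints {T : X →L[ℝ] (κ → ℝ)}
    (hT : T ∈ (Metric.closedBall (0 : X →L[ℝ] (κ → ℝ)) 1).extremePoints ℝ) (i : κ) :
    row T i ∈ (Metric.closedBall (0 : X →L[ℝ] ℝ) 1).extremePoints ℝ := by
  classical
  rw [mem_extremePoints_iff_left] at hT ⊢
  obtain ⟨hT_mem, hext⟩ := hT
  have hrow_le (k : κ) : ‖row T k‖ ≤ 1 :=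
    (norm_row_le T k).trans (mem_closedBall_zero_iff.1 hT_mem)
  refine ⟨mem_closedBall_zero_iff.2 (hrow_le i), fun f hf g hg ⟨a, b, ha, hb, hab, hfg⟩ => ?_⟩
  let replaceRow (h : X →L[ℝ] ℝ) : X →L[ℝ] (κ → ℝ) :=
    ContinuousLinearMap.pi (Function.update (row T) i h)
  have hmem (h : X →L[ℝ] ℝ) (hh : h ∈ Metric.closedBall 0 1) :
      replaceRow h ∈ Metric.closedBall 0 1 := by
    refine mem_closedBall_zero_iff.2 <|
      ContinuousLinearMap.norm_pi_le_of_le (fun k => ?_) zero_le_one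
    rcases eq_or_ne k i with rfl | hk
    · rw [Function.update_self]
      exact mem_closedBall_zero_iff.1 hh
    · rw [Function.update_of_ne hk]
      exact hrow_le k
  have hseg : T ∈ openSegment ℝ (replaceRow f) (replaceRow g) := by
    refine ⟨a, b, ha, hb, hab, ?_⟩
    ext x k
    rcases eq_or_ne k i with rfl | hk
    · simpa [replaceRow] using DFunLike.congr_fun hfg x
    · simp [replaceRow, hk, ← add_mul, hab]
  rw [← hext _ (hmem f hf) _ (hmem g hg) hseg]
  ext x
  simp [replaceRow]

theorem hasNontrivialNormPreservingApprox_of_row_dominated [ProperSpace X]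
    {T : X →L[ℝ] (κ → ℝ)} (hT : ‖T‖ = 1) {i k : κ} (hik : i ≠ k) (hk : row T k ≠ 0)
    (hle : ∀ x, |T x k| ≤ |T x i|) : HasNontrivialNormPreservingApprox T := by
  classical
  refine hasNontrivialNormPreservingApprox_of_direction hT
    (R := -(row T k).smulRight (Pi.single k 1)) ?_ fun c hc => ?_
  · contrapose! hk
    ext x
    simpa using congrFun (DFunLike.congr_fun hk x) k
  set A := T + c • -(row T k).smulRight (Pi.single k 1)
  have hAk (x : X) : A x k = (1 - c) * T x k := by simp [A]; ring
  have hA_ne (x : X) {l : κ} (hl : l ≠ k) : A x l = T x l := by simp [A, hl]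
  have hnorm (x : X) : ‖T x‖ = ‖A x‖ := by
    apply le_antisymm
    · refine (pi_norm_le_iff_of_nonneg (norm_nonneg _)).2 fun l => ?_
      rcases eq_or_ne l k with rfl | hl
      · exact (hle x).trans (hA_ne x hik ▸ norm_le_pi_norm (A x) i)
      · exact hA_ne x hl ▸ norm_le_pi_norm (A x) l
    · refine (pi_norm_le_iff_of_nonneg (norm_nonneg _)).2 fun l => ?_
      rcases eq_or_ne l k with rfl | hl
      · rw [hAk, norm_mul, Real.norm_of_nonneg (sub_nonneg.2 hc.2.le)]
        exact (mul_le_of_le_one_left (norm_nonneg _) (by linarith [hc.1])).trans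
          (norm_le_pi_norm (T x) l)
      · exact hA_ne x hl ▸ norm_le_pi_norm (T x) l
  have hop : ‖T‖ = ‖A‖ := T.opNorm_ext A hnorm
  exact ⟨hop ▸ hT, by simp only [normAttainmentSet, hnorm, hop]⟩

end Row

section SignedCoordinateSelection

variable {ι κ : Type*}

/-- `T` lists distinct coordinates of its argument up to signs: `(T x) i = ± x (σ i)` with `σ`
injective, the sign depending on `i` only (by linearity, comparing absolute values at each `x`
suffices). In the square case these are the signed permutations. -/
def IsSignedCoordinateSelection (T : (ι → ℝ) →L[ℝ] (κ → ℝ)) : Prop :=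
  ∃ σ : κ → ι, Function.Injective σ ∧ ∀ x i, |T x i| = |x (σ i)|

variable [Fintype ι] [Fintype κ] {T A : (ι → ℝ) →L[ℝ] (κ → ℝ)} {ε : ℝ}

theorem exists_abs_apply_eq_abs_of_mem_extremePoints [Nonempty ι]
    (hT : T ∈ (Metric.closedBall (0 : (ι → ℝ) →L[ℝ] (κ → ℝ)) 1).extremePoints ℝ) :
    ∃ σ : κ → ι, ∀ x i, |T x i| = |x (σ i)| := by
  classical
  choose σ hσ using fun i =>
    exists_abs_apply_single_eq_one_of_mem_extremePoints (row_mem_extremePoints hT i)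
  have hrow_le (i : κ) : ‖row T i‖ ≤ 1 :=
    (norm_row_le T i).trans (mem_closedBall_zero_iff.1 hT.1)
  exact ⟨σ, fun x i => abs_apply_eq_abs_coord (hrow_le i) (hσ i) x⟩

theorem hasNontrivialNormPreservingApprox_of_not_isSignedCoordinateSelection (hT : ‖T‖ = 1)
    (h : ¬ IsSignedCoordinateSelection T) : HasNontrivialNormPreservingApprox T := by
  classical
  by_cases hext : T ∈ (Metric.closedBall (0 : (ι → ℝ) →L[ℝ] (κ → ℝ)) 1).extremePoints ℝ
  case neg => exact hasNontrivialNormPreservingApprox_of_notMem_extremePoints hT hext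
  have : Nonempty ι := by
    by_contra hι
    rw [not_nonempty_iff] at hι
    exact one_ne_zero (hT ▸ T.opNorm_subsingleton)
  obtain ⟨σ, hσ⟩ := exists_abs_apply_eq_abs_of_mem_extremePoints hext
  obtain ⟨i, k, hσik, hik⟩ : ∃ i k, σ i = σ k ∧ i ≠ k :=
    Function.not_injective_iff.1 fun hinj => h ⟨σ, hinj, hσ⟩
  refine hasNontrivialNormPreservingApprox_of_row_dominated hT hik ?_ fun x => ?_
  · intro hk
    have hTk : T (Pi.single (σ k) 1) k = 0 := DFunLike.congr_fun hk _
    simpa [hTk] using hσ (Pi.single (σ k) 1) k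
  · rw [hσ, hσ, hσik]

theorem abs_apply_lt_two_mul_of_coord_ne [DecidableEq ι] {σ : κ → ι}
    (hσ : ∀ x i, |T x i| = |x (σ i)|) (hTA : ‖T - A‖ < ε) {u : ι → ℝ} (hu : ‖u‖ ≤ 1) {j : ι}
    (huj : ‖u - Pi.single j 1‖ < ε) {k : κ} (hk : σ k ≠ j) : |A u k| < 2 * ε := by
  have hT_lt : |T u k| < ε := calc
    |T u k| = ‖(u - Pi.single j 1 : ι → ℝ) (σ k)‖ := by simp [hσ, hk]
    _ ≤ ‖u - Pi.single j 1‖ := norm_le_pi_norm _ _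
    _ < ε := huj
  have hdiff : |A u k - T u k| < ε := calc
    |A u k - T u k| ≤ ‖(A - T) u‖ := norm_le_pi_norm ((A - T) u) k
    _ ≤ ‖A - T‖ := (A - T).unit_le_opNorm u hu
    _ < ε := norm_sub_rev T A ▸ hTA
  linarith [abs_sub_abs_le_abs_sub (A u k) (T u k)]

theorem IsSignedCoordinateSelection.eq_of_isUniformBPBApprox (hT : IsSignedCoordinateSelection T)
    (hε : ε < 1 / 2) (hA : IsUniformBPBApprox ε T A) : A = T := by
  classical
  obtain ⟨σ, hσ, hTσ⟩ := hT
  obtain ⟨hT_norm, hA_norm, δ, hδ, happrox⟩ := hA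
  suffices hrow : ∀ i, row A i = row T i from
    ContinuousLinearMap.ext fun x => funext fun i => DFunLike.congr_fun (hrow i) x
  intro i
  have : Nonempty κ := ⟨i⟩
  have hTi : |row T i (Pi.single (σ i) 1)| = 1 := by simp [hTσ]
  have hTe : 1 ≤ ‖T (Pi.single (σ i) 1)‖ :=
    hTi.symm.le.trans (norm_le_pi_norm (T _) i)
  obtain ⟨u, ⟨hu, hAu⟩, hue, hTA⟩ :=
    happrox (Pi.single (σ i) 1) (by rw [Pi.norm_single, norm_one]) (by linarith)
  obtain ⟨k, hk⟩ := (IsGreatest.pi_norm (A u)).1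
  have hAuk : |A u k| = 1 := hk.trans (hAu.trans hA_norm)
  have hki : k = i := by
    by_contra hne
    linarith [abs_apply_lt_two_mul_of_coord_ne hTσ hTA hu.le hue (hσ.ne hne)]
  have hAi : ‖row A i‖ ≤ 1 := hA_norm ▸ norm_row_le A i
  have hAi_single : |row A i (Pi.single (σ i) 1)| = 1 :=
    abs_apply_single_eq_one_of_norm_sub_lt_one hAi hu.le (hki ▸ hAuk) (by linarith)
  refine eq_of_norm_sub_lt_one hAi (hT_norm ▸ norm_row_le T i) hAi_single hTi ?_
  have hdiff : ‖row A i - row T i‖ ≤ ‖T - A‖ := norm_sub_rev T A ▸ norm_row_le (A - T) i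
  linarith

theorem isSignedCoordinateSelection_iff_forall_isUniformBPBApprox_iff (hT : ‖T‖ = 1) :
    IsSignedCoordinateSelection T ↔
      ∃ ε₀ : ℝ, 0 < ε₀ ∧ ∀ ε : ℝ, 0 < ε → ε < ε₀ →
        ∀ A : (ι → ℝ) →L[ℝ] (κ → ℝ), IsUniformBPBApprox ε T A ↔ A = T := by
  constructor
  · refine fun h => ⟨1 / 2, one_half_pos, fun ε hε hε_lt A =>
      ⟨h.eq_of_isUniformBPBApprox hε_lt, ?_⟩⟩
    rintro rfl
    exact isUniformBPBApprox_of_normAttainmentSet_eq hT hT (by rwa [sub_self, norm_zero]) rfl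
  · rintro ⟨ε₀, hε₀, honly⟩
    by_contra h
    obtain ⟨A, ⟨hA, hAT⟩, -⟩ :=
      hasNontrivialNormPreservingApprox_of_not_isSignedCoordinateSelection hT h (ε₀ / 2)
        (half_pos hε₀)
    exact hAT ((honly _ (half_pos hε₀) (half_lt_self hε₀) A).1 hA)

theorem exists_abs_apply_eq_abs_of_leftInverse_of_rightInverse {S : (κ → ℝ) →L[ℝ] (ι → ℝ)}
    (hT : ‖T‖ ≤ 1) (hS : ‖S‖ ≤ 1) (hST : Function.LeftInverse S T)
    (hTS : Function.RightInverse S T) (i : κ) : ∃ j, ∀ x, |T x i| = |x j| := by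
  classical
  have hTi : |row T i (S (Pi.single i 1))| = 1 := by simp [hTS _]
  obtain ⟨j, hj⟩ : ∃ j, row T i (Pi.single j 1) ≠ 0 :=
    exists_apply_single_ne_zero fun h => by simp [h] at hTi
  have hSe : ‖S (Pi.single i 1)‖ ≤ 1 :=
    (S.unit_le_opNorm _ (by rw [Pi.norm_single, norm_one])).trans hS
  have hSj : |row S j (Pi.single i 1)| = 1 :=
    abs_coord_eq_one_of_abs_apply_eq_one ((norm_row_le T i).trans hT) hSe hTi hj
  refine ⟨j, fun x => ?_⟩
  calc |T x i| = |row S j (T x)| := (abs_apply_eq_abs_coord ((norm_row_le S j).trans hS) hSj _).symm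
    _ = |x j| := by simp [hST x]

end SignedCoordinateSelection

section Isometry

variable {ι : Type*} [Fintype ι] {T : (ι → ℝ) →L[ℝ] (ι → ℝ)}

theorem IsSignedCoordinateSelection.isometry (h : IsSignedCoordinateSelection T) : Isometry T := by
  obtain ⟨σ, hσ, hTσ⟩ := h
  refine AddMonoidHomClass.isometry_of_norm T fun x => ?_
  calc ‖T x‖ = ‖x ∘ σ‖ := by simp only [Pi.norm_def, nnnorm, Real.norm_eq_abs, hTσ]; rfl
    _ = ‖x‖ := (Finite.surjective_of_injective hσ).pi_norm_comp x

theorem isSignedCoordinateSelection_of_isometry (hT : Isometry T) :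
    IsSignedCoordinateSelection T := by
  classical
  let E : (ι → ℝ) ≃ₗᵢ[ℝ] (ι → ℝ) := LinearIsometry.toLinearIsometryEquiv
    ⟨T.toLinearMap, hT.norm_map_of_map_zero (map_zero T)⟩ rfl
  let S : (ι → ℝ) →L[ℝ] (ι → ℝ) := E.symm.toContinuousLinearEquiv
  have hST : Function.LeftInverse S T := E.symm_apply_apply
  have hTS : Function.RightInverse S T := E.apply_symm_apply
  have hT_norm : ‖T‖ ≤ 1 := T.opNorm_le_bound zero_le_one fun x =>
    ((E.norm_map x).trans (one_mul _).symm).le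
  have hS_norm : ‖S‖ ≤ 1 := S.opNorm_le_bound zero_le_one fun y =>
    ((E.symm.norm_map y).trans (one_mul _).symm).le
  choose σ hσ using fun i =>
    exists_abs_apply_eq_abs_of_leftInverse_of_rightInverse hT_norm hS_norm hST hTS i
  have hσ_surj : Function.Surjective σ := by
    intro j
    by_contra! hj
    have hTj : T (Pi.single j 1) = 0 := funext fun i => by
      simpa [hj i] using hσ i (Pi.single j 1)
    simpa [hTj] using congrFun (hST (Pi.single j 1)) j
  exact ⟨σ, Finite.injective_iff_surjective.2 hσ_surj, fun x i => hσ i x⟩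

theorem isometry_iff_isSignedCoordinateSelection : Isometry T ↔ IsSignedCoordinateSelection T :=
  ⟨isSignedCoordinateSelection_of_isometry, IsSignedCoordinateSelection.isometry⟩

end Isometry

end BPB

theorem mainTheorem7_general {ι κ : Type*} [Fintype ι] [Fintype κ]
    (T : (ι → ℝ) →L[ℝ] (κ → ℝ)) (hT : ‖T‖ = 1) :
    (BPB.IsSignedCoordinateSelection T ↔
      ∃ ε₀ : ℝ, 0 < ε₀ ∧ ∀ ε : ℝ, 0 < ε → ε < ε₀ →
        ∀ A : (ι → ℝ) →L[ℝ] (κ → ℝ), BPB.IsUniformBPBApprox ε T A ↔ A = T) ∧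
    (¬ BPB.IsSignedCoordinateSelection T → BPB.HasNontrivialNormPreservingApprox T) :=
  ⟨BPB.isSignedCoordinateSelection_iff_forall_isUniformBPBApprox_iff hT,
    BPB.hasNontrivialNormPreservingApprox_of_not_isSignedCoordinateSelection hT⟩

theorem mainTheorem7 (n : ℕ) :
    (∀ T : BPB.EllInfty n →L[ℝ] BPB.EllInfty n, ‖T‖ = 1 →
      (Isometry T ↔
        ∃ ε₀ : ℝ, 0 < ε₀ ∧ ∀ ε : ℝ, 0 < ε → ε < ε₀ →
          ∀ A : BPB.EllInfty n →L[ℝ] BPB.EllInfty n,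
            BPB.IsUniformBPBApprox ε T A ↔ A = T)) ∧
    BPB.HasNontrivialNormPreservingUniformBPB (BPB.EllInfty n) (BPB.EllInfty n) := by
  simp only [BPB.isometry_iff_isSignedCoordinateSelection,
    BPB.HasNontrivialNormPreservingUniformBPB]
  exact ⟨fun T hT => (mainTheorem7_general T hT).1, fun T hT => (mainTheorem7_general T hT).2⟩
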